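/- Let $n\ge 1$ and let $T=(T_1,\dots,T_n)$ be positive integers (thresholds). Consider the line $1\to 2\to\cdots\to n$ with source $1$ and root $n$, and the configurations $\Omega=\{(t_1,\dots,t_n)\in\mathbb{Z}^n : 0\le t_i\le T_i\}$. The source operator $\sigma_1:\Omega\to\Omega$ adds one grain at the smallest site $k\ge 1$ with $t_k<T_k$, and fixes $t$ if there is no such site. For $v\in[n]=\{1,\dots,n\}$ let $\theta_v:\Omega\to\Omega$ fix $t$ if $t_v=0$, and otherwise decrease $t_v$ by $1$ and increase $t_k$ by $1$ for the smallest $k>v$ with $t_k<T_k$ (if there is no such $k$, the grain is lost). The Landslide topple operator is $\tau_v=\theta_v^{T_v}$. Let $y,x_1,\dots,x_n$ be real numbers (in the Markov chain these are positive with sum $1$; the identity below does not need this), and let $M_\tau$ be the $\Omega\times\Omega$ transition matrix of the Landslide model, in which from state $s$ one moves to $\sigma_1(s)$ with weight $y$ and to $\tau_v(s)$ with weight $x_v$; that is, $$(M_\tau)_{t,s}=y\,[\sigma_1(s)=t]+\sum_{v=1}^n x_v\,[\tau_v(s)=t].$$ Then the characteristic polynomial of $M_\tau$ is $$\det(\lambda\mathbb{1}-M_\tau)=(\lambda-y-x_{[n]})\prod_{\emptyset\subseteq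 S\subsetneq[n]}(\lambda-x_S)^{T_{S^c}},$$ where $S^c=[n]\setminus S$, $x_S=\sum_{i\in S}x_i$ and $T_S=\prod_{i\in S}T_i$. -/

import Mathlib

/-- Configurations of the sandpile model on the line `1 → 2 → ⋯ → n` with threshold vector `T`:
tuples `(t_1, …, t_n)` with `0 ≤ t_i ≤ T_i`. The sites are `Fin n`, so that `0 : Fin n` is the
source and the last element is the root. -/
abbrev LineState {n : ℕ} (T : Fin n → ℕ) : Type :=
  (i : Fin n) → Fin (T i + 1)

/-- Add one grain at the first site of index at least `k` that has not reached its threshold.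
If there is no such site, the configuration does not change (the grain leaves at the root). -/
def addGrain {n : ℕ} (T : Fin n → ℕ) (k : ℕ) (t : LineState T) : LineState T := fun w =>
  if h : k ≤ (w : ℕ) ∧ (t w : ℕ) < T w ∧
      ∀ u : Fin n, k ≤ (u : ℕ) → u < w → (t u : ℕ) = T u then
    ⟨(t w : ℕ) + 1, Nat.succ_lt_succ h.2.1⟩
  else t w

/-- The source operator `σ₁`: a grain enters at the first site and follows the line towards the
root until it finds a site that is not full. -/
def sourceOp {n : ℕ} (T : Fin n → ℕ) (t : LineState T) : LineState T :=
  addGrain T 0 t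

/-- The single-grain topple operator `θ_v`: if site `v` is not empty, one of its grains is taken
away and moved to the first non-full site strictly after `v` (or out of the system). -/
def toppleOne {n : ℕ} (T : Fin n → ℕ) (v : Fin n) (t : LineState T) : LineState T :=
  if (t v : ℕ) = 0 then t
  else addGrain T ((v : ℕ) + 1)
    (Function.update t v ⟨(t v : ℕ) - 1, lt_of_le_of_lt (Nat.sub_le _ _) (t v).isLt⟩)

/-- The topple operator of the Landslide model, `τ_v = θ_v ^ T_v`. -/
def landslide {n : ℕ} (T : Fin n → ℕ) (v : Fin n) : LineState T → LineState T :=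
  (toppleOne T v)^[T v]

/-- The transition matrix of the Landslide model on the line: from the configuration `s`, the
chain moves to `σ₁ s` with weight `y` and to `τ_v s` with weight `x v`. The entry `(t, s)` is the
weight of going from `s` to `t`, so that columns are indexed by the starting configuration. -/
noncomputable def landslideMatrix {n : ℕ} (T : Fin n → ℕ) (x : Fin n → ℝ) (y : ℝ) :
    Matrix (LineState T) (LineState T) ℝ :=
  Matrix.of fun t s =>
    (if sourceOp T s = t then y else 0) + ∑ v : Fin n, if landslide T v s = t then x v else 0

/-!
The transpose of the transition matrix acts on real functions on the configurations by
`f ↦ y • f ∘ σ₁ + ∑ v, x v • f ∘ τ_v`. The pullbacks along `σ₁` and along all the `τ_v` are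
triangular in a common basis, with diagonal entries `0` and `1`; the characteristic polynomial is
therefore a product of linear factors, and it remains to count the diagonal entries.

The basis is built by induction on the number of sites. A configuration is a pair `(a, t)` of the
content `a` of the first site and a configuration `t` of the rest of the line, with source operator
`σ'`. For `δ_a ⊗ f : (c, t) ↦ [c = a] f t` one finds

* `(δ_a ⊗ f) ∘ σ₁ = δ_(a-1) ⊗ f`, with `δ_(-1) = 0`, plus `δ_a ⊗ (f ∘ σ')` if `a = T 0`
  (`firstSite_comp_sourceOp`);
* `(δ_0 ⊗ f) ∘ τ_0 = ∑ j, δ_j ⊗ (f ∘ σ' ^ j)`, while `(δ_a ⊗ f) ∘ τ_0 = 0` for `a ≠ 0`, because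
  `τ_0` empties the first site and sends all its grains to the source of the rest
  (`firstSite_comp_landslide_zero`);
* `(δ_a ⊗ f) ∘ τ_(v+1) = δ_a ⊗ (f ∘ τ'_v)` (`firstSite_comp_landslide_succ`).

Suppose that a basis for the rest of the line contains the constant function `1`, and that the
pullback along `σ'` sends each other member to a combination of earlier ones. Then the constant
function, the `δ_a ⊗ 1` with `a < T 0`, and the `δ_a ⊗ f` with `f ≠ 1`, ordered by `f` first and by
`a` second, have the same property for the whole line (`IsTriangularFamily.step`). A nonconstant
member `f` on which the diagonal entries `1` are those of the sites in `D` gives one new member with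
diagonal set `{0} ∪ D` and `T 0` new members with diagonal set `D`; the constant function gives the
full set once and the set of the later sites `T 0` times. Hence a set `S` of sites occurs
`∏ i ∈ Sᶜ, T i` times. The source operator has diagonal entry `1` on the constant function only,
which accounts for the factor with `y`.
-/

/-! ### Triangular endomorphisms -/

open Polynomial in
/-- If an endomorphism sends each vector of a basis to a multiple of itself plus a combination of
basis vectors of smaller rank, its characteristic polynomial is read off from the multipliers.
Distinct basis vectors may share a rank. -/
theorem charpoly_eq_prod_of_triangular {ι V : Type*} [Fintype ι] [DecidableEq ι]
    [AddCommGroup V] [Module ℝ V] [Module.Finite ℝ V] [Module.Free ℝ V] (B : Module.Basis ι ℝ V)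
    (ρ : ι → ℕ) (d : ι → ℝ) (f : V →ₗ[ℝ] V)
    (h : ∀ i, f (B i) - d i • B i ∈ Submodule.span ℝ (B '' {j | ρ j < ρ i})) :
    f.charpoly = ∏ i, (X - C (d i)) := by
  have hrepr : ∀ i j, ¬ ρ i < ρ j →
      LinearMap.toMatrix B B f i j = if i = j then d j else 0 := by
    intro i j hij
    have h0 : B.repr (f (B j) - d j • B j) i = 0 := by
      by_contra hne
      have := B.repr_support_subset_of_mem_span _ (h j) (Finsupp.mem_support_iff.mpr hne)
      exact hij this
    rw [LinearMap.toMatrix_apply]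
    simp only [map_sub, map_smul, Finsupp.sub_apply, Finsupp.smul_apply, Module.Basis.repr_self,
      Finsupp.single_apply, smul_eq_mul, sub_eq_zero] at h0
    rw [h0]
    simp [eq_comm]
  rw [← LinearMap.charpoly_toMatrix f B, Matrix.charpoly]
  have htri : ((LinearMap.toMatrix B B f).charmatrix).BlockTriangular ρ := by
    intro i j hij
    have hne : i ≠ j := by rintro rfl; exact lt_irrefl _ hij
    rw [Matrix.charmatrix_apply_ne _ _ _ hne, hrepr i j hij.le.not_gt, if_neg hne]
    simp
  rw [htri.det]
  have hblock : ∀ a, ((LinearMap.toMatrix B B f).charmatrix.toSquareBlock ρ a) =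
      Matrix.diagonal fun i : {i // ρ i = a} => X - C (d i) := by
    intro a
    ext1 i j
    rcases eq_or_ne i j with rfl | hne
    · rw [Matrix.toSquareBlock_def, Matrix.of_apply, Matrix.charmatrix_apply_eq,
        hrepr _ _ (lt_irrefl _)]
      simp
    · have hne' : (i : ι) ≠ j := fun h => hne (Subtype.ext h)
      rw [Matrix.toSquareBlock_def, Matrix.of_apply, Matrix.charmatrix_apply_ne _ _ _ hne',
        hrepr _ _ (by rw [i.2, j.2]; exact lt_irrefl _), if_neg hne', Matrix.diagonal_apply_ne _ hne]
      simp
  simp only [hblock, Matrix.det_diagonal]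
  rw [← Finset.prod_fiberwise_of_maps_to (t := Finset.univ.image ρ)
    (fun i _ => Finset.mem_image_of_mem ρ (Finset.mem_univ i))]
  refine Finset.prod_congr rfl fun a _ => ?_
  rw [← Finset.prod_subtype (Finset.univ.filter fun i => ρ i = a) (by simp)
    (fun i => (X - C (d i) : ℝ[X]))]

/-! ### The operators in terms of the first site and the rest of the line -/

theorem addGrain_succ {n : ℕ} (T : Fin (n + 1) → ℕ) (k : ℕ) (s : LineState T) :
    addGrain T (k + 1) s =
      (Fin.cons (s 0) (addGrain (fun i => T i.succ) k fun i => s i.succ) : LineState T) := by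
  funext w
  refine Fin.cases ?_ (fun w => ?_) w
  · simp [addGrain]
  · simp only [Fin.cons_succ]
    unfold addGrain
    simp [Fin.forall_fin_succ, Fin.succ_lt_succ_iff]

theorem sourceOp_of_lt {n : ℕ} (T : Fin (n + 1) → ℕ) (s : LineState T) (h : (s 0 : ℕ) < T 0) :
    sourceOp T s =
      (Fin.cons ⟨(s 0 : ℕ) + 1, Nat.succ_lt_succ h⟩ (fun i => s i.succ) : LineState T) := by
  funext w
  refine Fin.cases ?_ (fun w => ?_) w
  · simp [sourceOp, addGrain, h]
  · simp only [Fin.cons_succ]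
    unfold sourceOp addGrain
    rw [dif_neg]
    rintro ⟨-, -, hu⟩
    exact h.ne (hu 0 (Nat.zero_le _) (Fin.succ_pos w))

theorem sourceOp_of_eq {n : ℕ} (T : Fin (n + 1) → ℕ) (s : LineState T) (h : (s 0 : ℕ) = T 0) :
    sourceOp T s =
      (Fin.cons (s 0) (sourceOp (fun i => T i.succ) fun i => s i.succ) : LineState T) := by
  funext w
  refine Fin.cases ?_ (fun w => ?_) w
  · simp [sourceOp, addGrain, h]
  · simp only [Fin.cons_succ]
    unfold sourceOp addGrain
    simp [Fin.forall_fin_succ, Fin.succ_lt_succ_iff, h]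

theorem toppleOne_succ {n : ℕ} (T : Fin (n + 1) → ℕ) (v : Fin n) (s : LineState T) :
    toppleOne T v.succ s =
      (Fin.cons (s 0) (toppleOne (fun i => T i.succ) v fun i => s i.succ) : LineState T) := by
  unfold toppleOne
  split_ifs with h
  · exact (Fin.cons_self_tail s).symm
  · rw [Fin.val_succ, addGrain_succ]
    have htail : ∀ a : Fin (T v.succ + 1), (fun i : Fin n => Function.update s v.succ a i.succ) =
        Function.update (fun i : Fin n => s i.succ) v a := by
      intro a
      funext i
      by_cases hi : i = v
      · subst hi; simp
      · rw [Function.update_of_ne hi, Function.update_of_ne (by simpa using hi)]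
    rw [htail, Function.update_of_ne (Fin.succ_ne_zero v).symm]

theorem landslide_succ {n : ℕ} (T : Fin (n + 1) → ℕ) (v : Fin n) (s : LineState T) :
    landslide T v.succ s =
      (Fin.cons (s 0) (landslide (fun i => T i.succ) v fun i => s i.succ) : LineState T) := by
  have key : ∀ m : ℕ, (toppleOne T v.succ)^[m] s = (Fin.cons (s 0)
      ((toppleOne (fun i => T i.succ) v)^[m] fun i => s i.succ) : LineState T) := by
    intro m
    induction m with
    | zero => exact (Fin.cons_self_tail s).symm
    | succ m ih =>
      rw [Function.iterate_succ_apply', ih, toppleOne_succ, Function.iterate_succ_apply']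
      simp
  exact key _

/-- Toppling the first site `T 0` times empties it, and each of its grains enters the rest of the
line at its source. -/
theorem landslide_zero {n : ℕ} (T : Fin (n + 1) → ℕ) (s : LineState T) :
    landslide T 0 s =
      (Fin.cons 0 ((sourceOp fun i => T i.succ)^[(s 0 : ℕ)] fun i => s i.succ) :
        LineState T) := by
  have step : ∀ s : LineState T, (s 0 : ℕ) ≠ 0 → toppleOne T 0 s =
      (Fin.cons ⟨(s 0 : ℕ) - 1, lt_of_le_of_lt (Nat.sub_le _ _) (s 0).isLt⟩
        (sourceOp (fun i => T i.succ) fun i => s i.succ) : LineState T) := by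
    intro s hs
    unfold toppleOne
    rw [if_neg hs, Fin.val_zero, addGrain_succ]
    simp [sourceOp]
  have key : ∀ (m : ℕ) (s : LineState T), (s 0 : ℕ) ≤ m → (toppleOne T 0)^[m] s =
      (Fin.cons 0 ((sourceOp fun i => T i.succ)^[(s 0 : ℕ)] fun i => s i.succ) :
        LineState T) := by
    intro m
    induction m with
    | zero =>
      intro s hs
      have h0 : (s 0 : ℕ) = 0 := by omega
      have h0' : s 0 = 0 := Fin.ext h0
      rw [h0, Function.iterate_zero_apply, Function.iterate_zero_apply, ← h0']
      exact (Fin.cons_self_tail s).symm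
    | succ m ih =>
      intro s hs
      rw [Function.iterate_succ_apply]
      by_cases h0 : (s 0 : ℕ) = 0
      · have h1 : toppleOne T 0 s = s := by simp [toppleOne, h0]
        rw [h1, ih s (by omega)]
      · obtain ⟨j, hj⟩ := Nat.exists_eq_succ_of_ne_zero h0
        rw [step s h0, ih _ (by simp; omega)]
        simp [hj]
  exact key _ _ (Nat.lt_succ_iff.mp (s 0).isLt)

/-! ### Simultaneous triangularization of the operators -/

/-- The span of the members of the family `b` of rank less than `k`. -/
def flagSpan {ι V : Type*} [AddCommGroup V] [Module ℝ V] (b : ι → V) (ρ : ι → ℕ) (k : ℕ) :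
    Submodule ℝ V :=
  Submodule.span ℝ (b '' {w | ρ w < k})

theorem mem_flagSpan {ι V : Type*} [AddCommGroup V] [Module ℝ V] {b : ι → V} {ρ : ι → ℕ} {k : ℕ}
    (w : ι) (h : ρ w < k) : b w ∈ flagSpan b ρ k :=
  Submodule.subset_span ⟨w, h, rfl⟩

theorem flagSpan_mono {ι V : Type*} [AddCommGroup V] [Module ℝ V] (b : ι → V) (ρ : ι → ℕ)
    {k l : ℕ} (h : k ≤ l) : flagSpan b ρ k ≤ flagSpan b ρ l :=
  Submodule.span_mono (Set.image_mono fun _ hw => lt_of_lt_of_le hw h)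

theorem map_mem_of_mem_flagSpan {ι V W : Type*} [AddCommGroup V] [Module ℝ V] [AddCommGroup W]
    [Module ℝ W] {b : ι → V} {ρ : ι → ℕ} {k : ℕ} (f : V →ₗ[ℝ] W) (P : Submodule ℝ W)
    (h : ∀ w, ρ w < k → f (b w) ∈ P) {x : V} (hx : x ∈ flagSpan b ρ k) : f x ∈ P := by
  have : flagSpan b ρ k ≤ P.comap f := by
    refine Submodule.span_le.mpr ?_
    rintro _ ⟨w, hw, rfl⟩
    exact h w hw
  exact this hx

/-- A family of functions on the configurations that triangularizes, simultaneously, the pullbacks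
along the source operator and along all the topple operators. The index `none` stands for the
constant function `1`, `ρ` orders the family, and `D` lists the sites `v` for which the pullback
along `landslide T v` has diagonal entry `1` (the other diagonal entries being `0`). The source
operator has diagonal entry `1` at `none` and `0` elsewhere. -/
structure IsTriangularFamily {n : ℕ} (T : Fin n → ℕ) {κ : Type} [Fintype κ]
    (b : Option κ → LineState T → ℝ) (ρ : Option κ → ℕ) (D : Option κ → Finset (Fin n)) :
    Prop where
  none_eq : b none = 1
  set_none : D none = Finset.univ
  rank_none : ρ none = 0
  source_mem : ∀ u, b (some u) ∘ sourceOp T ∈ flagSpan b ρ (ρ (some u))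
  topple_mem : ∀ v u, b (some u) ∘ landslide T v - (if v ∈ D (some u) then b (some u) else 0) ∈
    flagSpan b ρ (ρ (some u))
  span_eq : Submodule.span ℝ (Set.range b) = ⊤
  card_eq : Fintype.card (Option κ) = Fintype.card (LineState T)
  prod_eq : ∀ f : Finset (Fin n) → Polynomial ℝ,
    ∏ w, f (D w) = ∏ S, f S ^ ∏ i ∈ Sᶜ, T i

/-- The family at `n = 0`: the constant function on the single configuration. -/
theorem isTriangularFamily_of_zero (T : Fin 0 → ℕ) :
    IsTriangularFamily T (κ := Empty) (fun _ => 1) (fun _ => 0) (fun _ => Finset.univ) where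
  none_eq := rfl
  set_none := rfl
  rank_none := rfl
  source_mem := nofun
  topple_mem := nofun
  span_eq := by
    refine eq_top_iff.mpr fun f _ => ?_
    have : f = f default • (1 : LineState T → ℝ) := by
      funext s
      simp [Subsingleton.elim s default]
    rw [this]
    exact Submodule.smul_mem _ _ (Submodule.subset_span ⟨none, rfl⟩)
  card_eq := by simp
  prod_eq f := by
    rw [Fintype.prod_option, Fintype.prod_empty, Fintype.prod_unique]
    simp [Subsingleton.elim (default : Finset (Fin 0)) ∅]

/-! ### Functions supported on one content of the first site -/

/-- The function that is `f` of the configuration on the later sites where the first site holds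
`a` grains, and `0` elsewhere. -/
def firstSite {n : ℕ} (T : Fin (n + 1) → ℕ) (a : ℕ) :
    (LineState (fun i : Fin n => T i.succ) → ℝ) →ₗ[ℝ] (LineState T → ℝ) where
  toFun f := fun s => if (s 0 : ℕ) = a then f fun i => s i.succ else 0
  map_add' f g := by funext s; by_cases h : (s 0 : ℕ) = a <;> simp [h]
  map_smul' c f := by funext s; by_cases h : (s 0 : ℕ) = a <;> simp [h]

theorem firstSite_apply {n : ℕ} (T : Fin (n + 1) → ℕ) (a : ℕ)
    (f : LineState (fun i : Fin n => T i.succ) → ℝ) (s : LineState T) :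
    firstSite T a f s = if (s 0 : ℕ) = a then f fun i => s i.succ else 0 := rfl

theorem firstSite_comp_sourceOp {n : ℕ} (T : Fin (n + 1) → ℕ) (a : ℕ)
    (f : LineState (fun i : Fin n => T i.succ) → ℝ) :
    firstSite T a f ∘ sourceOp T =
      (if a = 0 ∨ T 0 < a then 0 else firstSite T (a - 1) f) +
        if a = T 0 then firstSite T (T 0) (f ∘ sourceOp fun i => T i.succ) else 0 := by
  funext s
  have hs := (s 0).isLt
  rcases (Nat.lt_succ_iff.mp hs).lt_or_eq with h | h
  · simp only [Function.comp_apply, sourceOp_of_lt T s h, firstSite_apply, Pi.add_apply,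
      Fin.cons_zero, Fin.cons_succ]
    by_cases ha : a = 0 ∨ T 0 < a
    · rw [if_pos ha, if_neg (by omega)]
      split_ifs <;> simp [firstSite_apply, h.ne]
    · rw [if_neg ha, firstSite_apply]
      by_cases hb : (s 0 : ℕ) + 1 = a
      · rw [if_pos hb, if_pos (by omega)]
        split_ifs <;> simp [firstSite_apply, h.ne]
      · rw [if_neg hb, if_neg (by omega)]
        split_ifs <;> simp [firstSite_apply, h.ne]
  · simp only [Function.comp_apply, sourceOp_of_eq T s h, firstSite_apply, Pi.add_apply,
      Fin.cons_zero, Fin.cons_succ]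
    have h1 : (if a = 0 ∨ T 0 < a then (0 : LineState T → ℝ) else firstSite T (a - 1) f) s = 0 := by
      split_ifs with ha
      · rfl
      · rw [firstSite_apply, if_neg (by omega)]
    rw [h1, zero_add, h]
    by_cases ha : T 0 = a
    · rw [if_pos ha, if_pos ha.symm, firstSite_apply, if_pos h]; rfl
    · rw [if_neg ha, if_neg (Ne.symm ha)]; rfl

theorem firstSite_comp_landslide_succ {n : ℕ} (T : Fin (n + 1) → ℕ) (a : ℕ) (v : Fin n)
    (f : LineState (fun i : Fin n => T i.succ) → ℝ) :
    firstSite T a f ∘ landslide T v.succ =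
      firstSite T a (f ∘ landslide (fun i => T i.succ) v) := by
  funext s
  simp [firstSite_apply, landslide_succ]

theorem firstSite_comp_landslide_zero {n : ℕ} (T : Fin (n + 1) → ℕ) (a : ℕ)
    (f : LineState (fun i : Fin n => T i.succ) → ℝ) :
    firstSite T a f ∘ landslide T 0 = if a = 0 then
      ∑ j ∈ Finset.range (T 0 + 1), firstSite T j (f ∘ (sourceOp fun i => T i.succ)^[j])
      else 0 := by
  funext s
  simp only [Function.comp_apply, firstSite_apply, landslide_zero, Fin.cons_zero, Fin.cons_succ,
    Fin.val_zero]
  by_cases ha : a = 0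
  · rw [if_pos ha.symm, if_pos ha, Finset.sum_apply, Finset.sum_eq_single (s 0 : ℕ)]
    · simp [firstSite_apply]
    · intro j _ hj
      rw [firstSite_apply, if_neg (Ne.symm hj)]
    · intro hj
      exact absurd (Finset.mem_range.mpr (s 0).isLt) hj
  · rw [if_neg (Ne.symm ha), if_neg ha]; rfl

theorem sum_firstSite_one {n : ℕ} (T : Fin (n + 1) → ℕ) :
    ∑ j ∈ Finset.range (T 0 + 1), firstSite T j 1 = 1 := by
  funext s
  rw [Finset.sum_apply, Finset.sum_eq_single (s 0 : ℕ)]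
  · simp [firstSite_apply]
  · intro j _ hj
    rw [firstSite_apply, if_neg (Ne.symm hj)]
  · intro hj
    exact absurd (Finset.mem_range.mpr (s 0).isLt) hj

/-! ### Products over the subsets of the sites -/

theorem prod_finset_fin_succ {M : Type*} [CommMonoid M] {n : ℕ} (f : Finset (Fin (n + 1)) → M) :
    ∏ S, f S = ∏ S : Finset (Fin n),
      f (insert 0 (S.map (Fin.succEmb n))) * f (S.map (Fin.succEmb n)) := by
  have hpow : (Finset.univ.map ⟨Fin.succ, Fin.succ_injective n⟩).powerset =
      Finset.univ.map (Finset.mapEmbedding (Fin.succEmb n)).toEmbedding := by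
    change (Finset.univ.map (Fin.succEmb n)).powerset = _
    ext S
    simp only [Finset.mem_powerset, Finset.subset_map_iff, Finset.mem_map, Finset.mem_univ,
      true_and, Finset.subset_univ]
    simp [eq_comm]
  rw [← Finset.powerset_univ, Fin.univ_succ, Finset.cons_eq_insert,
    Finset.prod_powerset_insert (by simp), ← Finset.prod_mul_distrib, hpow, Finset.prod_map]
  exact Finset.prod_congr rfl fun S _ => mul_comm _ _

/-! ### Adding a site in front of the line -/

section Step

variable {n : ℕ} (T : Fin (n + 1) → ℕ) {κ : Type}

/-- The inductive step of the triangular family: on a line with one more site in front, a member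
`b (some u)` is put on top of each content of the first site, and the constant function on top of
each content but the full one; the constant function `1` stands for the latter. -/
def stepFamily (b : Option κ → LineState (fun i : Fin n => T i.succ) → ℝ) :
    Option (Fin (T 0) ⊕ Fin (T 0 + 1) × κ) → LineState T → ℝ
  | none => 1
  | some (.inl a) => firstSite T a 1
  | some (.inr (a, u)) => firstSite T a (b (some u))

/-- The ranks of `stepFamily`: ordered by the member of the old family first, and by the content of
the first site second. -/
def stepRank (ρ : Option κ → ℕ) : Option (Fin (T 0) ⊕ Fin (T 0 + 1) × κ) → ℕ
  | none => 0
  | some (.inl a) => a + 1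
  | some (.inr (a, u)) => (T 0 + 1) * ρ (some u) + a + 1

/-- The diagonal entries of the topple operators on `stepFamily`. -/
def stepSet (D : Option κ → Finset (Fin n)) :
    Option (Fin (T 0) ⊕ Fin (T 0 + 1) × κ) → Finset (Fin (n + 1))
  | none => Finset.univ
  | some (.inl _) => Finset.univ.map (Fin.succEmb n)
  | some (.inr (a, u)) => if a = 0 then insert 0 ((D (some u)).map (Fin.succEmb n))
      else (D (some u)).map (Fin.succEmb n)

variable {T} [Fintype κ] {b : Option κ → LineState (fun i : Fin n => T i.succ) → ℝ}
  {ρ : Option κ → ℕ} {D : Option κ → Finset (Fin n)}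

/-- The function `firstSite T (T 0) 1`, which is not a member of `stepFamily`, is recovered from
the constant function `1`. -/
theorem IsTriangularFamily.firstSite_basis_mem (h : IsTriangularFamily (fun i => T i.succ) b ρ D)
    {a : ℕ} (ha : a ≤ T 0) (w : Option κ) :
    firstSite T a (b w) ∈ flagSpan (stepFamily T b) (stepRank T ρ) ((T 0 + 1) * (ρ w + 1) + 1) := by
  cases w with
  | some u =>
    refine mem_flagSpan (b := stepFamily T b)
      (some (.inr (⟨a, Nat.lt_succ_of_le ha⟩, u))) ?_
    simp only [stepRank]
    rw [mul_add]
    omega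
  | none =>
    have hlt : ∀ j < T 0, firstSite T j 1 ∈
        flagSpan (stepFamily T b) (stepRank T ρ) ((T 0 + 1) * (ρ none + 1) + 1) := by
      intro j hj
      refine mem_flagSpan (b := stepFamily T b) (some (.inl ⟨j, hj⟩)) ?_
      simp only [stepRank, h.rank_none]
      omega
    rw [h.none_eq]
    rcases ha.lt_or_eq with ha | rfl
    · exact hlt a ha
    · have hsum := sum_firstSite_one T
      rw [Finset.sum_range_succ, ← eq_sub_iff_add_eq'] at hsum
      rw [hsum]
      exact Submodule.sub_mem _ (mem_flagSpan (b := stepFamily T b) none (by simp [stepRank]))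
        (Submodule.sum_mem _ fun j hj => hlt j (Finset.mem_range.mp hj))

theorem IsTriangularFamily.firstSite_mem (h : IsTriangularFamily (fun i => T i.succ) b ρ D)
    {a k : ℕ} (ha : a ≤ T 0) {f : LineState (fun i : Fin n => T i.succ) → ℝ}
    (hf : f ∈ flagSpan b ρ k) :
    firstSite T a f ∈ flagSpan (stepFamily T b) (stepRank T ρ) ((T 0 + 1) * k + 1) :=
  map_mem_of_mem_flagSpan _ _ (fun w hw => flagSpan_mono _ _
    (Nat.succ_le_succ (Nat.mul_le_mul_left _ hw)) (h.firstSite_basis_mem ha w)) hf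

/-- The pullback along the source operator lowers the ranks of the nonconstant members and fixes the
constant one, so pulling back once or more stays strictly below the starting rank. -/
theorem IsTriangularFamily.comp_iterate_sourceOp_mem {T : Fin n → ℕ}
    {b : Option κ → LineState T → ℝ}
    (h : IsTriangularFamily T b ρ D) (u : κ) (j : ℕ) :
    b (some u) ∘ (sourceOp T)^[j + 1] ∈ flagSpan b ρ (ρ (some u)) := by
  induction j with
  | zero => exact h.source_mem u
  | succ j ih =>
    rw [Function.iterate_succ, ← Function.comp_assoc]
    refine map_mem_of_mem_flagSpan (LinearMap.funLeft ℝ ℝ (sourceOp T)) _ (fun w hw => ?_) ih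
    cases w with
    | none =>
      have : LinearMap.funLeft ℝ ℝ (sourceOp T) (b none) = b none := by rw [h.none_eq]; rfl
      rw [this]
      exact mem_flagSpan none hw
    | some w => exact flagSpan_mono _ _ hw.le (h.source_mem w)

theorem IsTriangularFamily.step_source_mem (h : IsTriangularFamily (fun i => T i.succ) b ρ D)
    (u : Fin (T 0) ⊕ Fin (T 0 + 1) × κ) : stepFamily T b (some u) ∘ sourceOp T ∈
      flagSpan (stepFamily T b) (stepRank T ρ) (stepRank T ρ (some u)) := by
  rcases u with a | ⟨a, u⟩
  · simp only [stepFamily]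
    rw [firstSite_comp_sourceOp, if_neg a.isLt.ne, add_zero]
    split_ifs with ha
    · exact Submodule.zero_mem _
    · refine mem_flagSpan (b := stepFamily T b)
        (some (.inl ⟨(a : ℕ) - 1, lt_of_le_of_lt (Nat.sub_le _ _) a.isLt⟩)) ?_
      simp only [stepRank]
      omega
  · simp only [stepFamily]
    rw [firstSite_comp_sourceOp]
    refine Submodule.add_mem _ ?_ ?_
    · split_ifs with ha
      · exact Submodule.zero_mem _
      · refine mem_flagSpan (b := stepFamily T b)
          (some (.inr (⟨(a : ℕ) - 1, lt_of_le_of_lt (Nat.sub_le _ _) a.isLt⟩, u))) ?_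
        simp only [stepRank]
        omega
    · split_ifs with ha
      · refine flagSpan_mono _ _ ?_ (h.firstSite_mem le_rfl (h.source_mem u))
        simp only [stepRank]
        omega
      · exact Submodule.zero_mem _

theorem IsTriangularFamily.step_topple_zero_mem (h : IsTriangularFamily (fun i => T i.succ) b ρ D)
    (u : Fin (T 0) ⊕ Fin (T 0 + 1) × κ) : stepFamily T b (some u) ∘ landslide T 0 -
      (if 0 ∈ stepSet T D (some u) then stepFamily T b (some u) else 0) ∈
      flagSpan (stepFamily T b) (stepRank T ρ) (stepRank T ρ (some u)) := by
  rcases u with a | ⟨a, u⟩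
  · rw [if_neg (by simp [stepSet]), sub_zero]
    simp only [stepFamily]
    rw [firstSite_comp_landslide_zero]
    split_ifs with ha
    · have : ∑ j ∈ Finset.range (T 0 + 1), firstSite T j
          ((1 : LineState (fun i : Fin n => T i.succ) → ℝ) ∘ (sourceOp fun i => T i.succ)^[j]) =
          stepFamily T b none := sum_firstSite_one T
      rw [this]
      exact mem_flagSpan none (by simp [stepRank])
    · exact Submodule.zero_mem _
  · have hmem : 0 ∈ stepSet T D (some (.inr (a, u))) ↔ a = 0 := by
      simp only [stepSet]
      split_ifs with ha <;> simp [ha]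
    simp only [hmem, stepFamily]
    rw [firstSite_comp_landslide_zero]
    by_cases ha : a = 0
    · -- The term `j = 0` of the sum is the diagonal one; the others have passed `sourceOp`.
      subst ha
      rw [if_pos (Fin.val_zero _), if_pos rfl, Finset.sum_range_succ']
      simp only [Fin.val_zero, Function.iterate_zero, Function.comp_id, add_sub_cancel_right]
      refine Submodule.sum_mem _ fun j hj => ?_
      exact h.firstSite_mem (Finset.mem_range.mp hj) (h.comp_iterate_sourceOp_mem u j)
    · rw [if_neg fun h0 : (a : ℕ) = 0 => ha (Fin.ext h0), if_neg ha, sub_zero]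
      exact Submodule.zero_mem _

theorem IsTriangularFamily.step_topple_succ_mem (h : IsTriangularFamily (fun i => T i.succ) b ρ D)
    (v : Fin n) (u : Fin (T 0) ⊕ Fin (T 0 + 1) × κ) :
    stepFamily T b (some u) ∘ landslide T v.succ -
      (if v.succ ∈ stepSet T D (some u) then stepFamily T b (some u) else 0) ∈
      flagSpan (stepFamily T b) (stepRank T ρ) (stepRank T ρ (some u)) := by
  rcases u with a | ⟨a, u⟩
  · rw [if_pos (by simp [stepSet])]
    simp only [stepFamily]
    rw [firstSite_comp_landslide_succ]
    convert Submodule.zero_mem _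
    exact sub_self _
  · have hmem : v.succ ∈ stepSet T D (some (.inr (a, u))) ↔ v ∈ D (some u) := by
      simp only [stepSet]
      split_ifs <;> simp
    have hif : (if v ∈ D (some u) then firstSite T a (b (some u)) else 0) =
        firstSite T a (if v ∈ D (some u) then b (some u) else 0) := by
      split_ifs <;> simp
    simp only [hmem, stepFamily]
    rw [firstSite_comp_landslide_succ, hif, ← map_sub]
    refine flagSpan_mono _ _ ?_
      (h.firstSite_mem (Nat.lt_succ_iff.mp a.isLt) (h.topple_mem v u))
    simp only [stepRank]
    omega

theorem IsTriangularFamily.step_span_eq (h : IsTriangularFamily (fun i => T i.succ) b ρ D) :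
    Submodule.span ℝ (Set.range (stepFamily T b)) = ⊤ := by
  refine eq_top_iff.mpr fun f _ => ?_
  have hf : f = ∑ a : Fin (T 0 + 1), firstSite T a
      fun t => f (Fin.cons a t : LineState T) := by
    funext s
    rw [Finset.sum_apply, Finset.sum_eq_single (s 0)]
    · rw [firstSite_apply, if_pos rfl]
      exact congrArg f (Fin.cons_self_tail s).symm
    · intro a _ ha
      rw [firstSite_apply, if_neg fun h => ha (Fin.ext h).symm]
    · simp
  rw [hf]
  refine Submodule.sum_mem _ fun a _ => ?_
  have hle : Submodule.span ℝ (Set.range b) ≤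
      (Submodule.span ℝ (Set.range (stepFamily T b))).comap (firstSite T a) := by
    refine Submodule.span_le.mpr ?_
    rintro _ ⟨w, rfl⟩
    exact Submodule.span_mono (Set.image_subset_range _ _)
      (h.firstSite_basis_mem (Nat.lt_succ_iff.mp a.isLt) w)
  exact hle (h.span_eq ▸ Submodule.mem_top)

/-- Splitting the subsets of the sites by whether they contain the first one: each index of the old
family yields one new index whose set contains the first site and `T 0` whose set does not. -/
theorem IsTriangularFamily.step_prod_eq (h : IsTriangularFamily (fun i => T i.succ) b ρ D)
    (f : Finset (Fin (n + 1)) → Polynomial ℝ) :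
    ∏ w, f (stepSet T D w) = ∏ S, f S ^ ∏ i ∈ Sᶜ, T i := by
  have hins : ∀ S : Finset (Fin n), ∏ i ∈ (insert 0 (S.map (Fin.succEmb n)))ᶜ, T i =
      ∏ i ∈ Sᶜ, T i.succ := by
    intro S
    have : (insert 0 (S.map (Fin.succEmb n)))ᶜ = Sᶜ.map (Fin.succEmb n) := by
      ext i
      refine Fin.cases ?_ (fun i => ?_) i <;> simp
    rw [this, Finset.prod_map]
    rfl
  have hmap : ∀ S : Finset (Fin n), ∏ i ∈ (S.map (Fin.succEmb n))ᶜ, T i =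
      T 0 * ∏ i ∈ Sᶜ, T i.succ := by
    intro S
    have : (S.map (Fin.succEmb n))ᶜ = insert 0 (Sᶜ.map (Fin.succEmb n)) := by
      ext i
      refine Fin.cases ?_ (fun i => ?_) i <;> simp
    rw [this, Finset.prod_insert (by simp), Finset.prod_map]
    rfl
  have huniv : insert 0 (Finset.univ.map (Fin.succEmb n)) =
      (Finset.univ : Finset (Fin (n + 1))) := by
    ext i
    refine Fin.cases ?_ (fun i => ?_) i <;> simp
  -- The inductive hypothesis, for the function that collects the factors over one subset.
  have hprod := h.prod_eq fun S =>
    f (insert 0 (S.map (Fin.succEmb n))) * f (S.map (Fin.succEmb n)) ^ T 0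
  rw [prod_finset_fin_succ]
  simp only [hins, hmap, pow_mul, ← mul_pow]
  rw [← hprod, Fintype.prod_option, Fintype.prod_option, Fintype.prod_sum_type,
    Fintype.prod_prod_type, Fin.prod_univ_succ, h.set_none, huniv]
  simp [stepSet, Finset.prod_mul_distrib, Finset.prod_pow, mul_assoc]

theorem IsTriangularFamily.step (h : IsTriangularFamily (fun i => T i.succ) b ρ D) :
    IsTriangularFamily T (stepFamily T b) (stepRank T ρ) (stepSet T D) where
  none_eq := rfl
  set_none := rfl
  rank_none := rfl
  source_mem := h.step_source_mem
  topple_mem v := Fin.cases h.step_topple_zero_mem h.step_topple_succ_mem v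
  span_eq := h.step_span_eq
  card_eq := by
    have hc := h.card_eq
    simp only [Fintype.card_option, Fintype.card_sum, Fintype.card_prod, Fintype.card_fin,
      Fintype.card_pi] at hc ⊢
    rw [Fin.prod_univ_succ, ← hc]
    ring
  prod_eq := h.step_prod_eq

end Step

/-! ### The characteristic polynomial -/

theorem IsTriangularFamily.charpoly_eq {n : ℕ} {T : Fin n → ℕ} {κ : Type} [Fintype κ]
    {b : Option κ → LineState T → ℝ} {ρ : Option κ → ℕ} {D : Option κ → Finset (Fin n)}
    (h : IsTriangularFamily T b ρ D) (x : Fin n → ℝ) (y : ℝ) :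
    (landslideMatrix T x y).charpoly =
      (Polynomial.X - Polynomial.C (y + ∑ i, x i)) *
        ∏ S ∈ (Finset.univ : Finset (Fin n)).ssubsets,
          (Polynomial.X - Polynomial.C (∑ i ∈ S, x i)) ^ (∏ i ∈ Sᶜ, T i) := by
  classical
  have hpull : ∀ f : LineState T → ℝ, (landslideMatrix T x y).transpose.mulVec f =
      y • (f ∘ sourceOp T) + ∑ v, x v • (f ∘ landslide T v) := by
    intro f
    funext s
    simp only [Matrix.mulVec, dotProduct, Matrix.transpose_apply, landslideMatrix, Matrix.of_apply,
      add_mul, Finset.sum_add_distrib, Finset.sum_mul, ite_mul, zero_mul, Pi.add_apply,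
      Pi.smul_apply, Finset.sum_apply, smul_eq_mul, Function.comp_apply]
    rw [Finset.sum_comm]
    simp
  let B : Module.Basis (Option κ) ℝ (LineState T → ℝ) :=
    basisOfTopLeSpanOfCardEqFinrank b h.span_eq.ge 
      (by rw [h.card_eq, Module.finrank_fintype_fun_eq_card])
  have hB : ⇑B = b := coe_basisOfTopLeSpanOfCardEqFinrank _ _ _
  let d : Option κ → ℝ := fun w => w.elim (y + ∑ i, x i) fun u => ∑ i ∈ D (some u), x i
  rw [← Matrix.charpoly_transpose, ← Matrix.charpoly_toLin',
    charpoly_eq_prod_of_triangular B ρ d]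
  · -- `prod_eq` has one more factor on each side, that of the full set; it is cancelled.
    have hfull : (Finset.univ : Finset (Finset (Fin n))) =
        insert Finset.univ (Finset.univ : Finset (Fin n)).ssubsets := by
      ext S
      simp [Finset.mem_ssubsets, Finset.ssubset_univ_iff, em]
    have hprod := h.prod_eq fun S => Polynomial.X - Polynomial.C (∑ i ∈ S, x i)
    rw [hfull, Finset.prod_insert (by simp), Fintype.prod_option, h.set_none] at hprod
    simp only [Finset.compl_univ, Finset.prod_empty, pow_one] at hprod
    rw [Fintype.prod_option, ← mul_left_cancel₀ (Polynomial.X_sub_C_ne_zero _) hprod]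
    rfl
  · intro w
    rw [hB, Matrix.toLin'_apply, hpull]
    cases w with
    | none =>
      simp only [h.none_eq, d, Option.elim, add_smul, Finset.sum_smul]
      convert Submodule.zero_mem _
      rw [sub_eq_zero]
      rfl
    | some u =>
      have : y • (b (some u) ∘ sourceOp T) + ∑ v, x v • (b (some u) ∘ landslide T v) -
          d (some u) • b (some u) = y • (b (some u) ∘ sourceOp T) + ∑ v, x v •
            (b (some u) ∘ landslide T v - (if v ∈ D (some u) then b (some u) else 0)) := by
        simp only [smul_sub, Finset.sum_sub_distrib, d, Option.elim, Finset.sum_smul, smul_ite,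
          smul_zero, Finset.sum_ite_mem, Finset.univ_inter]
        abel
      rw [this]
      exact Submodule.add_mem _ (Submodule.smul_mem _ _ (h.source_mem u))
        (Submodule.sum_mem _ fun v _ => Submodule.smul_mem _ _ (h.topple_mem v u))

theorem exists_isTriangularFamily (n : ℕ) (T : Fin n → ℕ) :
    ∃ (κ : Type) (_ : Fintype κ) (b : Option κ → LineState T → ℝ) (ρ : Option κ → ℕ)
      (D : Option κ → Finset (Fin n)), IsTriangularFamily T b ρ D := by
  induction n with
  | zero => exact ⟨Empty, inferInstance, _, _, _, isTriangularFamily_of_zero T⟩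
  | succ n ih =>
    obtain ⟨κ, _, b, ρ, D, h⟩ := ih fun i => T i.succ
    exact ⟨_, inferInstance, _, _, _, h.step⟩

theorem mainTheorem8 (n : ℕ) (hn : 1 ≤ n) (T : Fin n → ℕ) (hT : ∀ i, 1 ≤ T i)
    (x : Fin n → ℝ) (y : ℝ) :
    (landslideMatrix T x y).charpoly =
      (Polynomial.X - Polynomial.C (y + ∑ i, x i)) *
        ∏ S ∈ (Finset.univ : Finset (Fin n)).ssubsets,
          (Polynomial.X - Polynomial.C (∑ i ∈ S, x i)) ^ (∏ i ∈ Sᶜ, T i) := by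
  obtain ⟨κ, _, b, ρ, D, h⟩ := exists_isTriangularFamily n T
  exact h.charpoly_eq x y
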